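/- Let $k$ be an algebraically closed field and let $G$ be a linear algebraic group over $k$. A $G$-module is a finite-dimensional rational representation $V$ of $G$ over $k$; $G$ acts on the ring $k[V]$ of polynomial functions by $(g\cdot f)(v)=f(g^{-1}v)$, and $k[V]^G$ is the ring of invariants. Let $$\mathcal N_{G,V}=\{v\in V : f(v)=0 \text{ for all } f\in k[V]^G \text{ with } f(0)=0\},$$ let $\sigma(G,V)$ be the least integer $d\ge 0$ such that for every $v\in V\setminus\mathcal N_{G,V}$ there is $f\in k[V]^G$ of degree at most $d$ with $f(0)=0$ and $f(v)\neq 0$, and let $\sigma(G)\in\mathbb N\cup\{\infty\}$ be the supremum of $\sigma(G,V)$ over all $G$-modules $V$. A closed subgroup of $G$ is regarded as a linear algebraic group in its own right. (a) Let $H\subseteq G$ be a closed subgroup of finite index and let $V$ be an $H$-module. Then $\operatorname{Ind}_H^G(V)=k[G]\otimes_{k[H]}V$ (where here $k[G]$, $k[H]$ denote group algebras) is a $G$-module, and $$\sigma(H,V)\le\sigma(G,\operatorname{Ind}_H^G(V))\le\sigma(G).$$ In particular $\sigma(H)\le\sigma(G)$. (b) Let $G^0$ be the connected component of $G$ (in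 the Zariski topology) containing the identity. Then $[G:G^0]$ is finite, $$\sigma(G)\le[G:G^0]\,\sigma(G^0)\quad\text{and}\quad\sigma(G^0)\le\sigma(G).$$ In particular, $\sigma(G)$ and $\sigma(G^0)$ are either both finite or both infinite. -/

import Mathlib

open scoped Topology

universe u v w

/-! ### Polynomial invariants of a representation and the number `σ(G, V)` -/

section Invariants

variable {k : Type u} [Field k] {G : Type v} [Group G] {V : Type w} [AddCommGroup V] [Module k V]

/-- The evaluation of a polynomial expression in linear forms on `V` as a function on `V`. -/
noncomputable def polyEval (k : Type u) [Field k] (V : Type w) [AddCommGroup V] [Module k V] :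
    MvPolynomial (Module.Dual k V) k →ₐ[k] (V → k) :=
  MvPolynomial.aeval fun (φ : Module.Dual k V) (x : V) => φ x

/-- The ring `k[V]` of polynomial functions on `V`. -/
noncomputable def polyFun (k : Type u) [Field k] (V : Type w) [AddCommGroup V] [Module k V] :
    Subalgebra k (V → k) :=
  (polyEval k V).range

/-- The polynomial functions on `V` of degree at most `d`. -/
noncomputable def polyFunLE (k : Type u) [Field k] (V : Type w) [AddCommGroup V] [Module k V]
    (d : ℕ) : Submodule k (V → k) :=
  (MvPolynomial.restrictTotalDegree (Module.Dual k V) k d).map (polyEval k V).toLinearMap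

/-- The ring `k[V]^G` of invariants for the action `(g • f) x = f (g⁻¹ x)`. -/
noncomputable def polyInvariants (ρ : Representation k G V) : Subalgebra k (V → k) where
  carrier := {f | f ∈ polyFun k V ∧ ∀ g x, f (ρ g⁻¹ x) = f x}
  mul_mem' := fun ha hb => ⟨mul_mem ha.1 hb.1, fun g x => by simp only [Pi.mul_apply, ha.2, hb.2]⟩
  add_mem' := fun ha hb => ⟨add_mem ha.1 hb.1, fun g x => by simp only [Pi.add_apply, ha.2, hb.2]⟩
  algebraMap_mem' := fun r => ⟨(polyFun k V).algebraMap_mem r, fun _ _ => rfl⟩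

/-- The set of invariants of degree at most `d`. -/
def polyInvariantsLE (ρ : Representation k G V) (d : ℕ) : Set (V → k) :=
  {f | f ∈ polyInvariants ρ ∧ f ∈ polyFunLE k V d}

/-- The nullcone: the common zero set of all invariants without constant term. -/
def nullcone (ρ : Representation k G V) : Set V :=
  {x | ∀ f ∈ polyInvariants ρ, f 0 = 0 → f x = 0}

/-- `S` is a `σ`-set: every point outside the nullcone is separated from zero by an element of `S`
without constant term. -/
def IsSigmaSet (ρ : Representation k G V) (S : Set (V → k)) : Prop :=
  ∀ x, x ∉ nullcone ρ → ∃ f ∈ S, f 0 = 0 ∧ f x ≠ 0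

/-- `σ(G, V)`: the least `d` such that the invariants of degree at most `d` form a `σ`-set. -/
noncomputable def sigmaRep (ρ : Representation k G V) : ℕ∞ :=
  ⨅ (d : ℕ) (_ : IsSigmaSet ρ (polyInvariantsLE ρ d)), (d : ℕ∞)

end Invariants

/-! ### Linear algebraic groups -/

/-- A linear algebraic group structure over the (algebraically closed) field `k` on the group `G`:
`G` is an affine variety, given by its finitely generated algebra of regular functions, whose
characters are exactly the evaluations at points of `G`, and multiplication `G × G → G` and
inversion `G → G` are morphisms of varieties. -/
structure LinearAlgebraicGroup (k : Type u) [Field k] (G : Type v) [Group G] where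
  /-- The coordinate ring `k[G]`. -/
  regular : Subalgebra k (G → k)
  fg : regular.FG
  points : ∀ χ : regular →ₐ[k] k, ∃! g : G, ∀ f : regular, χ f = f.1 g
  /-- The pullback of a regular function under multiplication lies in `k[G] ⊗ k[G]`. -/
  mul_regular : ∀ f ∈ regular, ∃ (n : ℕ) (a b : Fin n → G → k),
    (∀ i, a i ∈ regular) ∧ (∀ i, b i ∈ regular) ∧ ∀ x y, f (x * y) = ∑ i, a i x * b i y
  inv_regular : ∀ f ∈ regular, (fun x => f x⁻¹) ∈ regular

namespace LinearAlgebraicGroup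

variable {k : Type u} [Field k] {G : Type v} [Group G] (A : LinearAlgebraicGroup k G)

/-- The Zariski topology: closed sets are the zero sets of sets of regular functions. -/
@[reducible]
def zariski : TopologicalSpace G :=
  TopologicalSpace.ofClosed
    {Z | ∃ S : Set (G → k), S ⊆ A.regular ∧ Z = {g | ∀ f ∈ S, f g = 0}}
    ⟨{1}, by
      rintro _ rfl
      exact one_mem A.regular, by ext; simp⟩
    (by
      intro 𝒵 h𝒵
      refine ⟨{f | f ∈ A.regular ∧ ∃ Z ∈ 𝒵, ∀ g ∈ Z, f g = 0}, fun f hf => hf.1, ?_⟩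
      ext g
      constructor
      · rintro hg f ⟨-, Z, hZ, hf⟩
        exact hf g (hg Z hZ)
      · intro hg Z hZ
        obtain ⟨S, hS, rfl⟩ := h𝒵 hZ
        exact fun f hf => hg f ⟨hS hf, _, hZ, fun x hx => hx f hf⟩)
    (by
      rintro _ ⟨S, hS, rfl⟩ _ ⟨T, hT, rfl⟩
      refine ⟨{h | ∃ f ∈ S, ∃ f' ∈ T, h = f * f'}, ?_, ?_⟩
      · rintro _ ⟨f, hf, f', hf', rfl⟩
        exact mul_mem (hS hf) (hT hf')
      · ext g
        constructor
        · rintro (hg | hg) _ ⟨f, hf, f', hf', rfl⟩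
          · simp [hg f hf]
          · simp [hg f' hf']
        · intro hg
          by_contra hcon
          rw [Set.mem_union, not_or] at hcon
          simp only [Set.mem_ofPred_eq, not_forall] at hcon
          obtain ⟨⟨f, hf, hfg⟩, f', hf', hfg'⟩ := hcon
          exact mul_ne_zero hfg hfg' (hg _ ⟨f, hf, f', hf', rfl⟩))

theorem isClosed_zariski_iff (Z : Set G) :
    IsClosed[A.zariski] Z ↔
      ∃ S : Set (G → k), S ⊆ A.regular ∧ Z = {g | ∀ f ∈ S, f g = 0} := by
  rw [← @isOpen_compl_iff _ _ A.zariski]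
  change Zᶜᶜ ∈ {Z | ∃ S : Set (G → k), S ⊆ A.regular ∧ Z = {g | ∀ f ∈ S, f g = 0}} ↔ _
  rw [compl_compl]
  rfl

theorem left_translate_mem {f : G → k} (hf : f ∈ A.regular) (g : G) :
    (fun x => f (g * x)) ∈ A.regular := by
  obtain ⟨n, a, b, -, hb, h⟩ := A.mul_regular f hf
  have : (fun x => f (g * x)) = ∑ i, a i g • b i := by
    ext x
    simp [h]
  rw [this]
  exact sum_mem fun i _ => A.regular.smul_mem (hb i) _

theorem continuous_mul_left (g : G) :
    Continuous[A.zariski, A.zariski] (fun x => g * x) := by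
  let := A.zariski
  rw [continuous_iff_isClosed]
  intro Z hZ
  obtain ⟨S, hS, rfl⟩ := (A.isClosed_zariski_iff Z).1 hZ
  refine (A.isClosed_zariski_iff _).2 ⟨{f | ∃ f' ∈ S, f = fun x => f' (g * x)}, ?_, ?_⟩
  · rintro _ ⟨f', hf', rfl⟩
    exact A.left_translate_mem (hS hf') g
  · ext x
    constructor
    · rintro hx _ ⟨f', hf', rfl⟩
      exact hx f' hf'
    · intro hx f hf
      exact hx _ ⟨f, hf, rfl⟩

/-- Restriction of functions from `G` to a subgroup. -/
def restrictFun (k : Type u) [Field k] {G : Type v} [Group G] (H : Subgroup G) :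
    (G → k) →ₐ[k] (H → k) where
  toFun f := fun h => f h
  map_one' := rfl
  map_mul' _ _ := rfl
  map_zero' := rfl
  map_add' _ _ := rfl
  commutes' _ := rfl

/-- A closed subgroup as a linear algebraic group; its regular functions are the restrictions of
the regular functions on `G`. -/
def ofClosed (H : Subgroup G) (hH : IsClosed[A.zariski] (H : Set G)) :
    LinearAlgebraicGroup k H where
  regular := A.regular.map (restrictFun k H)
  fg := A.fg.map _
  points := by
    intro χ
    let r : A.regular →ₐ[k] A.regular.map (restrictFun k H) :=
      ((restrictFun k H).comp A.regular.val).codRestrict _ fun f => ⟨f.1, f.2, rfl⟩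
    obtain ⟨g, hg, huniq⟩ := A.points (χ.comp r)
    obtain ⟨S, hS, hHS⟩ := (A.isClosed_zariski_iff _).1 hH
    have hgH : g ∈ (H : Set G) := by
      rw [hHS]
      intro f hf
      have h0 : r ⟨f, hS hf⟩ = 0 := by
        apply Subtype.ext
        funext x
        have hx : (x : G) ∈ (H : Set G) := x.2
        rw [hHS] at hx
        exact hx f hf
      have h1 := hg ⟨f, hS hf⟩
      rw [AlgHom.comp_apply, h0, map_zero] at h1
      exact h1.symm
    refine ⟨⟨g, hgH⟩, ?_, ?_⟩
    · rintro ⟨_, f, hf, rfl⟩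
      exact hg ⟨f, hf⟩
    · intro y hy
      exact Subtype.ext (huniq y fun f => hy (r f))
  mul_regular := by
    rintro _ ⟨f, hf, rfl⟩
    obtain ⟨n, a, b, ha, hb, h⟩ := A.mul_regular f hf
    exact ⟨n, fun i => restrictFun k H (a i), fun i => restrictFun k H (b i),
      fun i => ⟨a i, ha i, rfl⟩, fun i => ⟨b i, hb i, rfl⟩, fun x y => h x y⟩
  inv_regular := by
    rintro _ ⟨f, hf, rfl⟩
    exact ⟨_, A.inv_regular f hf, rfl⟩

/-- The identity component `G⁰`: the Zariski-connected component of `1`. -/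
def identityComponent : Subgroup G :=
  letI := A.zariski
  have key : ∀ g x : G, x ∈ connectedComponent (1 : G) → g * x ∈ connectedComponent (1 : G) →
      ∀ y ∈ connectedComponent (1 : G), g * y ∈ connectedComponent (1 : G) := by
    intro g x hx hgx y hy
    have hpre : IsPreconnected ((fun z => g * z) '' connectedComponent (1 : G)) :=
      isPreconnected_connectedComponent.image _ (A.continuous_mul_left g).continuousOn
    have hsub := hpre.subset_connectedComponent ⟨x, hx, rfl⟩
    rw [← connectedComponent_eq hgx] at hsub
    exact hsub ⟨y, hy, rfl⟩
  { carrier := connectedComponent (1 : G)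
    one_mem' := mem_connectedComponent
    mul_mem' := fun {a b} ha hb =>
      key a 1 mem_connectedComponent (by simpa using ha) b hb
    inv_mem' := fun {a} ha => by
      have := key a⁻¹ a ha (by simpa using mem_connectedComponent) 1 mem_connectedComponent
      simpa using this }

theorem isClosed_identityComponent :
    IsClosed[A.zariski] (A.identityComponent : Set G) :=
  letI := A.zariski
  isClosed_connectedComponent

/-- A representation of `G` is rational if all its matrix coefficients are regular functions. The
`G`-modules are the finite-dimensional rational representations. -/
def IsRational {V : Type w} [AddCommGroup V] [Module k V] (ρ : Representation k G V) : Prop :=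
  ∀ (φ : Module.Dual k V) (x : V), (fun g => φ (ρ g x)) ∈ A.regular

/-- `σ(G)`: the supremum of `σ(G, V)` over all `G`-modules `V`. -/
noncomputable def sigma : ℕ∞ :=
  ⨆ (V : Type u) (_ : AddCommGroup V) (_ : Module k V) (_ : FiniteDimensional k V)
    (ρ : Representation k G V) (_ : A.IsRational ρ), sigmaRep ρ

end LinearAlgebraicGroup

/-!
Let `H` be a closed subgroup of finite index in `G`.

The inclusion `V → Ind V`, `v ↦ ⟦1 ⊗ v⟧`, is `H`-equivariant, so `G`-invariants of `Ind V` restrict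
to `H`-invariants of `V` without raising the degree. Conversely, an `H`-invariant `f` of `V` with
`f 0 = 0` is the restriction of the `G`-invariant `∑ f(w_q)`, where `w_q` is the component of
`w ∈ Ind V` at the coset `q` (`sum_indComponent_mem_polyInvariants`). Hence a point outside the
nullcone of `V` stays outside the nullcone of `Ind V`, and `σ(H, V) ≤ σ(G, Ind V)`
(`sigmaRep_le_sigmaRep_ind`). The matrix coefficients of `Ind V` are, coset by coset, translates of
coefficients of `V` extended by zero. They are regular because the indicator function of `H` is, by
the Nullstellensatz on `G` (`indicator_mem_regular`, `isRational_ind`).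

In the other direction, if `x` lies outside the nullcone of a `G`-module, then so do all its
translates, and these lie outside the smaller nullcone for `H`. As `k` is infinite, one `H`-invariant
of degree at most `σ(H)` without constant term is nonzero at the translates of `x` by
representatives of all cosets. Its relative norm, the product of its translates over the cosets, is
a `G`-invariant of degree at most `[G : H] σ(H)` that is nonzero at `x` (`isSigmaSet_index_mul`).

The identity component has finite index because `G` is a Noetherian space, with finitely many
irreducible components, and two points of the same component lie in the same coset of `G⁰`.
-/

/-! ### Polynomial functions -/

section PolynomialFunctions

variable {k : Type u} [Field k] {V : Type v} [AddCommGroup V] [Module k V]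
  {W : Type w} [AddCommGroup W] [Module k W]

theorem polyEval_apply (p : MvPolynomial (Module.Dual k V) k) (x : V) :
    polyEval k V p x = MvPolynomial.aeval (fun φ : Module.Dual k V => φ x) p := by
  have h : (Pi.evalAlgHom k (fun _ : V => k) x).comp (polyEval k V) =
      MvPolynomial.aeval (fun φ : Module.Dual k V => φ x) := by
    ext φ
    simp [polyEval]
  exact DFunLike.congr_fun h p

theorem mem_polyFun_iff_exists_mem_polyFunLE {f : V → k} :
    f ∈ polyFun k V ↔ ∃ d, f ∈ polyFunLE k V d := by
  constructor
  · rintro ⟨p, rfl⟩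
    exact ⟨p.totalDegree, p, (MvPolynomial.mem_restrictTotalDegree _ _ _).2 le_rfl, rfl⟩
  · rintro ⟨d, p, -, rfl⟩
    exact ⟨p, rfl⟩

theorem polyFunLE_mono {d e : ℕ} (h : d ≤ e) {f : V → k} (hf : f ∈ polyFunLE k V d) :
    f ∈ polyFunLE k V e := by
  obtain ⟨p, hp, rfl⟩ := hf
  exact ⟨p, (MvPolynomial.mem_restrictTotalDegree _ _ _).2
    (((MvPolynomial.mem_restrictTotalDegree _ _ _).1 hp).trans h), rfl⟩

theorem comp_linearMap_mem_polyFunLE {d : ℕ} {f : V → k} (hf : f ∈ polyFunLE k V d)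
    (L : W →ₗ[k] V) : (fun x => f (L x)) ∈ polyFunLE k W d := by
  obtain ⟨p, hp, rfl⟩ := hf
  refine ⟨MvPolynomial.rename (fun φ : Module.Dual k V => φ ∘ₗ L) p,
    (MvPolynomial.mem_restrictTotalDegree _ _ _).2
      ((MvPolynomial.totalDegree_rename_le _ _).trans
        ((MvPolynomial.mem_restrictTotalDegree _ _ _).1 hp)), ?_⟩
  ext x
  simp only [AlgHom.toLinearMap_apply, polyEval_apply, MvPolynomial.aeval_rename]
  rfl

theorem comp_linearMap_mem_polyFun {f : V → k} (hf : f ∈ polyFun k V) (L : W →ₗ[k] V) :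
    (fun x => f (L x)) ∈ polyFun k W := by
  obtain ⟨d, hd⟩ := mem_polyFun_iff_exists_mem_polyFunLE.1 hf
  exact mem_polyFun_iff_exists_mem_polyFunLE.2 ⟨d, comp_linearMap_mem_polyFunLE hd L⟩

theorem prod_mem_polyFunLE {ι : Type*} [Fintype ι] {d : ℕ} {f : ι → V → k}
    (hf : ∀ i, f i ∈ polyFunLE k V d) : ∏ i, f i ∈ polyFunLE k V (Fintype.card ι * d) := by
  choose p hp hpf using hf
  refine ⟨∏ i, p i, (MvPolynomial.mem_restrictTotalDegree _ _ _).2 ?_, ?_⟩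
  · refine (MvPolynomial.totalDegree_finsetProd _ _).trans ?_
    refine (Finset.sum_le_card_nsmul _ _ d fun i _ =>
      (MvPolynomial.mem_restrictTotalDegree _ _ _).1 (hp i)).trans ?_
    simp
  · simp only [AlgHom.toLinearMap_apply, map_prod] at hpf ⊢
    simp only [hpf]

end PolynomialFunctions

/-! ### Transfer of `σ` along equivariant maps -/

section Transfer

variable {k : Type u} [Field k] {G : Type*} [Group G] {H : Type*} [Group H]
  {V : Type v} [AddCommGroup V] [Module k V] {W : Type w} [AddCommGroup W] [Module k W]

/-- Invariants pull back along an equivariant linear map, so `σ` can only drop on the source as long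
as the map does not send a point outside the nullcone into the nullcone. -/
theorem sigmaRep_le_of_equivariant (j : H →* G) (ρ : Representation k H V)
    (τ : Representation k G W) (L : V →ₗ[k] W) (hL : ∀ h x, L (ρ h x) = τ (j h) (L x))
    (hnull : ∀ x, L x ∈ nullcone τ → x ∈ nullcone ρ) : sigmaRep ρ ≤ sigmaRep τ := by
  refine le_iInf₂ fun d hd => iInf₂_le d ?_
  intro x hx
  obtain ⟨f, ⟨⟨hf, hinv⟩, hdeg⟩, h0, hfx⟩ := hd (L x) fun h => hx (hnull x h)
  refine ⟨fun y => f (L y), ⟨⟨comp_linearMap_mem_polyFun hf L, fun g y => ?_⟩,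
    comp_linearMap_mem_polyFunLE hdeg L⟩, by simpa using h0, hfx⟩
  change f (L (ρ g⁻¹ y)) = f (L y)
  rw [hL, map_inv, hinv]

theorem sigmaRep_le_of_linearEquiv (ρ : Representation k G V) (τ : Representation k G W)
    (e : V ≃ₗ[k] W) (he : ∀ g x, e (ρ g x) = τ g (e x)) : sigmaRep ρ ≤ sigmaRep τ := by
  refine sigmaRep_le_of_equivariant (MonoidHom.id G) ρ τ e he fun x hx f hf h0 => ?_
  have := hx (fun y => f (e.symm y))
    ⟨comp_linearMap_mem_polyFun hf.1 e.symm.toLinearMap, fun g y => ?_⟩ (by simpa using h0)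
  · simpa using this
  · have h : e.symm (τ g⁻¹ y) = ρ g⁻¹ (e.symm y) := by
      rw [LinearEquiv.symm_apply_eq, he, LinearEquiv.apply_symm_apply]
    change f (e.symm (τ g⁻¹ y)) = f (e.symm y)
    rw [h, hf.2]

theorem sigmaRep_le_of_isSigmaSet {ρ : Representation k G V} {d : ℕ}
    (h : IsSigmaSet ρ (polyInvariantsLE ρ d)) : sigmaRep ρ ≤ d :=
  iInf₂_le d h

/-- The infimum defining `σ` is attained as soon as it is finite. -/
theorem isSigmaSet_of_sigmaRep_le {ρ : Representation k G V} {d : ℕ}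
    (h : sigmaRep ρ ≤ d) : IsSigmaSet ρ (polyInvariantsLE ρ d) := by
  by_contra hd
  have : ((d + 1 : ℕ) : ℕ∞) ≤ sigmaRep ρ := by
    refine le_iInf₂ fun e he => ?_
    by_contra hlt
    have hed : e ≤ d := by
      rw [not_le, Nat.cast_lt] at hlt
      omega
    refine hd fun x hx => ?_
    obtain ⟨f, hf, hf'⟩ := he x hx
    exact ⟨f, ⟨hf.1, polyFunLE_mono hed hf.2⟩, hf'⟩
  have := this.trans h
  rw [Nat.cast_le] at this
  omega

end Transfer

/-! ### Sums and products over cosets -/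

section Cosets

variable {k : Type u} [Field k] {G : Type v} [Group G] {H : Subgroup G}
  {V : Type w} [AddCommGroup V] [Module k V]

theorem apply_mul_out_eq_apply_smul_out {X : Type*} {φ : G → X}
    (hφ : ∀ g, ∀ h ∈ H, φ (g * h) = φ g) (x : G) (q : G ⧸ H) :
    φ (x * q.out) = φ (x • q).out := by
  have h : ((x * q.out : G) : G ⧸ H) = ((x • q).out : G) := by
    rw [QuotientGroup.out_eq', ← smul_eq_mul, MulAction.Quotient.coe_smul_out]
  have := hφ (x * q.out) _ (QuotientGroup.eq.1 h)
  rw [← this, mul_inv_cancel_left]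

variable [H.FiniteIndex]

/-- The relative norm: the product of the translates of an `H`-invariant polynomial function over
the cosets of `H` is a `G`-invariant. -/
theorem prod_cosets_mem_polyInvariantsLE (ρ : Representation k G V) {f : V → k} {d : ℕ}
    (hf : f ∈ polyInvariantsLE (ρ.comp H.subtype) d) :
    letI := Fintype.ofFinite (G ⧸ H)
    (∏ q : G ⧸ H, fun x => f (ρ q.out⁻¹ x)) ∈ polyInvariantsLE ρ (H.index * d) := by
  let := Fintype.ofFinite (G ⧸ H)
  have hdeg := prod_mem_polyFunLE (f := fun (q : G ⧸ H) x => f (ρ q.out⁻¹ x)) (d := d)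
    fun q => comp_linearMap_mem_polyFunLE hf.2 (ρ q.out⁻¹)
  rw [← Nat.card_eq_fintype_card, ← Subgroup.index_eq_card] at hdeg
  refine ⟨⟨mem_polyFun_iff_exists_mem_polyFunLE.2 ⟨_, hdeg⟩, fun g x => ?_⟩, hdeg⟩
  simp only [Finset.prod_apply]
  have hφ : ∀ a, ∀ h ∈ H, f (ρ (a * h)⁻¹ x) = f (ρ a⁻¹ x) := by
    intro a h hh
    have := hf.1.2 ⟨h, hh⟩ (ρ a⁻¹ x)
    rw [mul_inv_rev, map_mul]
    exact this
  rw [← Equiv.prod_comp (MulAction.toPerm g) fun q : G ⧸ H => f (ρ q.out⁻¹ x)]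
  refine Finset.prod_congr rfl fun q _ => ?_
  rw [MulAction.toPerm_apply,
    ← apply_mul_out_eq_apply_smul_out (φ := fun a => f (ρ a⁻¹ x)) hφ g q]
  simp [mul_inv_rev, map_mul]

/-- At a point outside the `G`-nullcone the translates by coset representatives all lie outside the
`H`-nullcone, so over an infinite field a single `H`-invariant is nonzero at all of them; its
relative norm is the required `G`-invariant. -/
theorem isSigmaSet_index_mul [Infinite k] (ρ : Representation k G V) {d : ℕ}
    (hd : IsSigmaSet (ρ.comp H.subtype) (polyInvariantsLE (ρ.comp H.subtype) d)) :
    IsSigmaSet ρ (polyInvariantsLE ρ (H.index * d)) := by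
  let := Fintype.ofFinite (G ⧸ H)
  intro x hx
  obtain ⟨f₀, hf₀, hf₀0, hf₀x⟩ : ∃ f ∈ polyInvariants ρ, f 0 = 0 ∧ f x ≠ 0 := by
    simpa [nullcone] using hx
  have hq : ∀ q : G ⧸ H, ρ q.out⁻¹ x ∉ nullcone (ρ.comp H.subtype) := fun q hmem =>
    hf₀x ((hf₀.2 q.out x).symm.trans (hmem f₀ ⟨hf₀.1, fun h y => hf₀.2 h y⟩ hf₀0))
  -- The invariants of degree at most `d` without constant term form a vector space, and over
  -- an infinite field it is not a finite union of the proper subspaces vanishing at one translate.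
  let p : Submodule k (V → k) :=
    (polyInvariants (ρ.comp H.subtype)).toSubmodule ⊓ polyFunLE k V d ⊓
      LinearMap.ker (LinearMap.proj (0 : V))
  obtain ⟨f, hfp, hf⟩ := Module.Dual.exists_forall_mem_ne_zero_of_forall_exists p
    (fun q : G ⧸ H => (LinearMap.proj (ρ q.out⁻¹ x) : (V → k) →ₗ[k] k)) fun q => by
      obtain ⟨f, hf, hf0, hfx⟩ := hd _ (hq q)
      exact ⟨f, ⟨⟨hf.1, hf.2⟩, hf0⟩, hfx⟩
  refine ⟨_, prod_cosets_mem_polyInvariantsLE ρ ⟨hfp.1.1, hfp.1.2⟩, ?_, ?_⟩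
  · have h0 : f 0 = 0 := hfp.2
    rw [Finset.prod_apply]
    exact Finset.prod_eq_zero (Finset.mem_univ ((1 : G) : G ⧸ H)) (by simp [h0])
  · rw [Finset.prod_apply]
    exact Finset.prod_ne_zero_iff.2 fun q _ => hf q

end Cosets

/-! ### The induced representation -/

section Induced

variable {k : Type u} [Field k] {G : Type v} [Group G] {H : Subgroup G}
  {V : Type w} [AddCommGroup V] [Module k V] (ρ : Representation k H V)

open Classical in
/-- The component of an element of the induced module `k[G] ⊗_{k[H]} V` at the coset representative
`g`: with Mathlib's convention `⟦h x ⊗ h v⟧ = ⟦x ⊗ v⟧`, it sends `⟦x ⊗ v⟧` to `(g⁻¹ x⁻¹) v` when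
`g⁻¹ x⁻¹ ∈ H` and to `0` otherwise. -/
noncomputable def indComponent (g : G) : Representation.IndV H.subtype ρ →ₗ[k] V :=
  Representation.Coinvariants.lift _
    (TensorProduct.lift ((Finsupp.linearCombination k fun x : G =>
        LinearMap.proj g⁻¹ ∘ₗ Rep.indToCoindAux (Rep.of ρ) x) ∘ₗ
      (MonoidAlgebra.coeffLinearEquiv k).toLinearMap))
    fun h => by
      ext x v
      simpa using Rep.indToCoindAux_mul_fst (A := Rep.of ρ) x g⁻¹ v h

open Classical in
theorem indComponent_mk (g x : G) (v : V) :
    indComponent ρ g (Representation.IndV.mk H.subtype ρ x v) =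
      Rep.indToCoindAux (Rep.of ρ) x v g⁻¹ := by
  simp [indComponent]

theorem indComponent_one_mk_one (v : V) :
    indComponent ρ 1 (Representation.IndV.mk H.subtype ρ 1 v) = v := by
  classical
  rw [indComponent_mk, inv_one]
  exact Rep.indToCoindAux_self (A := Rep.of ρ) 1 v

theorem indComponent_mk_one_of_notMem {g : G} (hg : g ∉ H) (v : V) :
    indComponent ρ g (Representation.IndV.mk H.subtype ρ 1 v) = 0 := by
  classical
  rw [indComponent_mk]
  refine Rep.indToCoindAux_of_not_rel _ _ _ ?_
  rintro ⟨h, hh⟩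
  have : (h : G) = g⁻¹ := by simpa [Subgroup.smul_def] using hh
  exact hg (by simpa [this] using H.inv_mem h.2)

theorem indComponent_mul (g : G) (h : H) (w : Representation.IndV H.subtype ρ) :
    indComponent ρ (g * h) w = ρ h⁻¹ (indComponent ρ g w) := by
  classical
  have : indComponent ρ (g * h) = ρ h⁻¹ ∘ₗ indComponent ρ g := by
    refine Representation.IndV.hom_ext _ _ fun x => LinearMap.ext fun v => ?_
    have := Rep.indToCoindAux_mul_snd (A := Rep.of ρ) x g⁻¹ v h⁻¹
    change indComponent ρ (g * h) (Representation.IndV.mk H.subtype ρ x v) =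
      ρ h⁻¹ (indComponent ρ g (Representation.IndV.mk H.subtype ρ x v))
    rw [indComponent_mk, indComponent_mk, mul_inv_rev]
    exact this
  rw [this]
  rfl

theorem indComponent_ind (a g : G) (w : Representation.IndV H.subtype ρ) :
    indComponent ρ g (Representation.ind H.subtype ρ a⁻¹ w) = indComponent ρ (a * g) w := by
  classical
  have : indComponent ρ g ∘ₗ Representation.ind H.subtype ρ a⁻¹ = indComponent ρ (a * g) := by
    refine Representation.IndV.hom_ext _ _ fun x => LinearMap.ext fun v => ?_
    have := Rep.indToCoindAux_snd_mul_inv (A := Rep.of ρ) x g⁻¹ a v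
    rw [LinearMap.comp_apply, LinearMap.comp_apply, Representation.ind_mk, inv_inv,
      indComponent_mk, LinearMap.comp_apply, indComponent_mk, mul_inv_rev, this]
  rw [← this]
  rfl

theorem indV_mk_mul (h : H) (x : G) (v : V) :
    Representation.IndV.mk H.subtype ρ (h * x) (ρ h v) = Representation.IndV.mk H.subtype ρ x v := by
  have := Representation.Coinvariants.mk_self_apply
    (Representation.tprod ((Representation.leftRegular k G).comp H.subtype) ρ) h
    (TensorProduct.tmul k (MonoidAlgebra.single x 1) v)
  simpa using this

theorem ind_mk_one (h : H) (v : V) :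
    Representation.ind H.subtype ρ h (Representation.IndV.mk H.subtype ρ 1 v) =
      Representation.IndV.mk H.subtype ρ 1 (ρ h v) := by
  rw [Representation.ind_mk, one_mul, ← indV_mk_mul ρ h, mul_inv_cancel]

theorem indV_mem_of_forall_mk_mem {p : Submodule k (Representation.IndV H.subtype ρ)}
    (hp : ∀ x v, Representation.IndV.mk H.subtype ρ x v ∈ p)
    (w : Representation.IndV H.subtype ρ) : w ∈ p := by
  have : p.mkQ = 0 := Representation.IndV.hom_ext _ _ fun x => LinearMap.ext fun v =>
    (Submodule.Quotient.mk_eq_zero p).2 (hp x v)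
  exact (Submodule.Quotient.mk_eq_zero p).1 (DFunLike.congr_fun this w)

variable [H.FiniteIndex]

/-- The sum of the components of an element of the induced module, each evaluated at an
`H`-invariant, is a `G`-invariant. On the summand `1 ⊗ V` it restricts to the given `H`-invariant
when that has no constant term. Hence `V → Ind V` preserves the complement of the nullcone. -/
theorem sum_indComponent_mem_polyInvariants {f : V → k} (hf : f ∈ polyInvariants ρ) :
    letI := Fintype.ofFinite (G ⧸ H)
    (∑ q : G ⧸ H, fun w => f (indComponent ρ q.out w)) ∈
      polyInvariants (Representation.ind H.subtype ρ) := by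
  let := Fintype.ofFinite (G ⧸ H)
  refine ⟨sum_mem fun q _ => comp_linearMap_mem_polyFun hf.1 _, fun a w => ?_⟩
  have hφ : ∀ g, ∀ h ∈ H, f (indComponent ρ (g * h) w) = f (indComponent ρ g w) := by
    intro g h hh
    rw [indComponent_mul ρ g ⟨h, hh⟩, hf.2]
  simp only [Finset.sum_apply, indComponent_ind]
  rw [← Equiv.sum_comp (MulAction.toPerm a) fun q : G ⧸ H => f (indComponent ρ q.out w)]
  exact Finset.sum_congr rfl fun q _ =>
    apply_mul_out_eq_apply_smul_out (φ := fun g => f (indComponent ρ g w)) hφ a q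

theorem sigmaRep_le_sigmaRep_ind :
    sigmaRep ρ ≤ sigmaRep (Representation.ind H.subtype ρ) := by
  let := Fintype.ofFinite (G ⧸ H)
  refine sigmaRep_le_of_equivariant H.subtype ρ _ (Representation.IndV.mk H.subtype ρ 1)
    (fun h v => (ind_mk_one ρ h v).symm) fun v hv f hf h0 => ?_
  have hsum := hv _ (sum_indComponent_mem_polyInvariants ρ hf) (by simp [h0])
  rw [Finset.sum_apply, Finset.sum_eq_single ((1 : G) : G ⧸ H)] at hsum
  · -- The chosen representative of the trivial coset lies in `H`, where invariance applies.
    have hmem : ((1 : G) : G ⧸ H).out ∈ H := by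
      simpa using QuotientGroup.eq.1 (QuotientGroup.out_eq' ((1 : G) : G ⧸ H)).symm
    rw [← one_mul ((1 : G) : G ⧸ H).out, indComponent_mul ρ 1 ⟨_, hmem⟩, hf.2,
      indComponent_one_mk_one] at hsum
    exact hsum
  · intro q _ hq
    rw [indComponent_mk_one_of_notMem, h0]
    intro hmem
    apply hq
    rw [← QuotientGroup.out_eq' q]
    exact QuotientGroup.eq.2 (by simpa using hmem)
  · simp

theorem finiteDimensional_indV [FiniteDimensional k V] :
    FiniteDimensional k (Representation.IndV H.subtype ρ) := by
  let := Fintype.ofFinite (G ⧸ H)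
  classical
  -- The copies of `V` at the finitely many coset representatives span the induced module.
  have hsurj : Function.Surjective
      (LinearMap.lsum k (fun _ : G ⧸ H => V) k
        fun q => Representation.IndV.mk H.subtype ρ q.out⁻¹) := by
    refine fun w => LinearMap.mem_range.1 (indV_mem_of_forall_mk_mem ρ (fun x v => ?_) w)
    have hmem : ((x⁻¹ : G) : G ⧸ H).out⁻¹ * x⁻¹ ∈ H := QuotientGroup.eq.1 (QuotientGroup.out_eq' _)
    refine ⟨Pi.single ((x⁻¹ : G) : G ⧸ H) (ρ ⟨_, hmem⟩ v), ?_⟩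
    rw [LinearMap.lsum_piSingle, ← indV_mk_mul ρ ⟨_, hmem⟩ x]
    simp
  exact Module.Finite.of_surjective _ hsurj

end Induced

/-! ### Closed subgroups of finite index -/

namespace LinearAlgebraicGroup

variable {k : Type u} [Field k] {G : Type v} [Group G] (A : LinearAlgebraicGroup k G)

theorem right_translate_mem {f : G → k} (hf : f ∈ A.regular) (g : G) :
    (fun x => f (x * g)) ∈ A.regular := by
  obtain ⟨n, a, b, ha, -, h⟩ := A.mul_regular f hf
  have : (fun x => f (x * g)) = ∑ i, b i g • a i := by
    ext x
    simp [h, mul_comm]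
  rw [this]
  exact sum_mem fun i _ => A.regular.smul_mem (ha i) _

/-- The weak Nullstellensatz on `G`: a proper ideal of the coordinate ring has a zero in `G`. -/
theorem exists_forall_mem_eq_zero [IsAlgClosed k] {I : Ideal A.regular} (hI : I ≠ ⊤) :
    ∃ g : G, ∀ f ∈ I, f.1 g = 0 := by
  obtain ⟨m, hm, hIm⟩ := I.exists_le_maximal hI
  let : Field (A.regular ⧸ m) := Ideal.Quotient.field m
  have : Algebra.FiniteType k A.regular := A.regular.fg_iff_finiteType.1 A.fg
  have : Algebra.FiniteType k (A.regular ⧸ m) := inferInstance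
  have : Module.Finite k (A.regular ⧸ m) := finite_of_finite_type_of_isJacobsonRing k _
  have : Algebra.IsIntegral k (A.regular ⧸ m) := Algebra.IsIntegral.of_finite _ _
  let e : k ≃ₐ[k] (A.regular ⧸ m) := AlgEquiv.ofBijective (Algebra.ofId k _)
    (IsAlgClosed.algebraMap_bijective_of_isIntegral (k := k) (K := A.regular ⧸ m))
  obtain ⟨g, hg, -⟩ := A.points (e.symm.toAlgHom.comp (Ideal.Quotient.mkₐ k m))
  refine ⟨g, fun f hf => ?_⟩
  rw [← hg f, AlgHom.comp_apply, Ideal.Quotient.mkₐ_eq_mk, Ideal.Quotient.eq_zero_iff_mem.2 (hIm hf),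
    map_zero]

/-- The ideal of regular functions vanishing on a subset of `G`. -/
def vanishingIdeal (Y : Set G) : Ideal A.regular :=
  ⨅ g ∈ Y, RingHom.ker ((Pi.evalRingHom (fun _ : G => k) g).comp A.regular.val.toRingHom)

theorem mem_vanishingIdeal {Y : Set G} {f : A.regular} :
    f ∈ A.vanishingIdeal Y ↔ ∀ g ∈ Y, f.1 g = 0 := by
  simp [vanishingIdeal, Submodule.mem_iInf, RingHom.mem_ker]

theorem mem_of_forall_mem_vanishingIdeal {Y : Set G} (hY : IsClosed[A.zariski] Y) {g : G}
    (hg : ∀ f ∈ A.vanishingIdeal Y, f.1 g = 0) : g ∈ Y := by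
  obtain ⟨S, hS, rfl⟩ := (A.isClosed_zariski_iff Y).1 hY
  exact fun f hf => hg ⟨f, hS hf⟩ (A.mem_vanishingIdeal.2 fun x hx => hx f hf)

/-- The indicator function of a clopen subset of `G` is regular, because the ideals of the subset
and of its complement have no common zero and hence are coprime. -/
theorem indicator_mem_regular [IsAlgClosed k] {Z : Set G} (hZ : IsClosed[A.zariski] Z)
    (hZc : IsClosed[A.zariski] Zᶜ) : Z.indicator 1 ∈ A.regular := by
  have htop : A.vanishingIdeal Z ⊔ A.vanishingIdeal Zᶜ = ⊤ := by
    by_contra h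
    obtain ⟨g, hg⟩ := A.exists_forall_mem_eq_zero h
    exact A.mem_of_forall_mem_vanishingIdeal hZc (fun f hf => hg f (Ideal.mem_sup_right hf))
      (A.mem_of_forall_mem_vanishingIdeal hZ fun f hf => hg f (Ideal.mem_sup_left hf))
  obtain ⟨a, ha, b, hb, hab⟩ := Submodule.mem_sup.1 ((Ideal.eq_top_iff_one _).1 htop)
  rw [mem_vanishingIdeal] at ha hb
  have : Z.indicator 1 = b.1 := by
    ext g
    by_cases hg : g ∈ Z
    · have := congrFun (congrArg Subtype.val hab) g
      simpa [hg, ha g hg] using this.symm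
    · simp [hg, hb g hg]
  rw [this]
  exact b.2

theorem isClosed_compl_of_finiteIndex {H : Subgroup G} (hH : IsClosed[A.zariski] (H : Set G))
    [H.FiniteIndex] : IsClosed[A.zariski] (H : Set G)ᶜ := by
  let := A.zariski
  have : (H : Set G)ᶜ = ⋃ q : {q : G ⧸ H // q ≠ (1 : G)}, (fun x => q.1.out⁻¹ * x) ⁻¹' H := by
    ext g
    simp only [Set.mem_compl_iff, SetLike.mem_coe, Set.mem_iUnion, Set.mem_preimage,
      ← QuotientGroup.eq, QuotientGroup.out_eq', Subtype.exists, exists_prop]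
    constructor
    · exact fun hg => ⟨g, fun h => hg (by simpa using QuotientGroup.eq.1 h.symm), rfl⟩
    · rintro ⟨q, hq, rfl⟩ hg
      exact hq (QuotientGroup.eq.2 (by simpa using hg))
  rw [this]
  exact isClosed_iUnion_of_finite fun q => hH.preimage (A.continuous_mul_left _)

/-- The matrix coefficients of the induced representation are regular: on each of the finitely many
cosets the coefficient is a translate of a coefficient of `V`, extended by zero. -/
theorem isRational_ind [IsAlgClosed k] {H : Subgroup G} (hH : IsClosed[A.zariski] (H : Set G))
    [H.FiniteIndex] {V : Type w} [AddCommGroup V] [Module k V] {ρ : Representation k H V}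
    (hρ : (A.ofClosed H hH).IsRational ρ) : A.IsRational (Representation.ind H.subtype ρ) := by
  let := Fintype.ofFinite (G ⧸ H)
  intro φ w
  refine indV_mem_of_forall_mk_mem ρ (p := A.regular.toSubmodule.comap
    (LinearMap.pi fun g => φ ∘ₗ Representation.ind H.subtype ρ g)) (fun x v => ?_) w
  choose r hr hrv using fun q : G ⧸ H =>
    hρ (φ ∘ₗ Representation.IndV.mk H.subtype ρ q.out⁻¹) v
  have hind := A.indicator_mem_regular hH (A.isClosed_compl_of_finiteIndex hH)
  have hsum : (fun g => φ (Representation.ind H.subtype ρ g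
      (Representation.IndV.mk H.subtype ρ x v))) = ∑ q : G ⧸ H, fun g =>
        ((H : Set G).indicator 1 * r q : G → k) (q.out⁻¹ * (g * x⁻¹)) := by
    ext g
    rw [Finset.sum_apply, Finset.sum_eq_single ((g * x⁻¹ : G) : G ⧸ H)]
    · have hmem : ((g * x⁻¹ : G) : G ⧸ H).out⁻¹ * (g * x⁻¹) ∈ H :=
        QuotientGroup.eq.1 (QuotientGroup.out_eq' _)
      have := congrFun (hrv ((g * x⁻¹ : G) : G ⧸ H)) ⟨_, hmem⟩
      rw [Pi.mul_apply, Set.indicator_of_mem (by exact hmem), Pi.one_apply, one_mul,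
        Representation.ind_mk, ← indV_mk_mul ρ ⟨_, hmem⟩]
      refine Eq.trans ?_ this.symm
      simp [mul_assoc]
    · intro q _ hq
      rw [Pi.mul_apply, Set.indicator_of_notMem, zero_mul]
      intro hmem
      apply hq
      rw [← QuotientGroup.out_eq' q]
      exact QuotientGroup.eq.2 hmem
    · simp
  change (fun g => φ (Representation.ind H.subtype ρ g
      (Representation.IndV.mk H.subtype ρ x v))) ∈ A.regular
  rw [hsum]
  exact sum_mem fun q _ =>
    A.right_translate_mem (A.left_translate_mem (mul_mem hind (hr q)) q.out⁻¹) x⁻¹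

/-! ### Bounds for `σ(G)` -/

theorem sigma_le_iff {s : ℕ∞} : A.sigma ≤ s ↔ ∀ (V : Type u) (_ : AddCommGroup V) (_ : Module k V)
    (_ : FiniteDimensional k V) (ρ : Representation k G V), A.IsRational ρ → sigmaRep ρ ≤ s := by
  simp only [sigma, iSup_le_iff]

theorem sigmaRep_le_sigma_of_universe {V : Type u} [AddCommGroup V] [Module k V]
    [FiniteDimensional k V] {ρ : Representation k G V} (hρ : A.IsRational ρ) :
    sigmaRep ρ ≤ A.sigma :=
  A.sigma_le_iff.1 le_rfl V _ _ inferInstance ρ hρ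

/-- `σ(G)` bounds `σ(G, V)` for modules in every universe, since each is isomorphic to some `kⁿ`. -/
theorem sigmaRep_le_sigma {V : Type w} [AddCommGroup V] [Module k V] [FiniteDimensional k V]
    {ρ : Representation k G V} (hρ : A.IsRational ρ) : sigmaRep ρ ≤ A.sigma := by
  let e := (Module.finBasis k V).equivFun
  let τ : Representation k G (Fin (Module.finrank k V) → k) :=
    { toFun := fun g => e.conj (ρ g)
      map_one' := by ext; simp
      map_mul' := fun g h => by ext; simp [LinearEquiv.conj_apply] }
  have hτ : A.IsRational τ := fun φ x => hρ (φ ∘ₗ e.toLinearMap) (e.symm x)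
  refine (sigmaRep_le_of_linearEquiv ρ τ e fun g x => ?_).trans ?_
  · simp [τ, LinearEquiv.conj_apply]
  · exact A.sigmaRep_le_sigma_of_universe hτ

theorem sigma_ofClosed_le [IsAlgClosed k] {H : Subgroup G} (hH : IsClosed[A.zariski] (H : Set G))
    [H.FiniteIndex] : (A.ofClosed H hH).sigma ≤ A.sigma := by
  refine (sigma_le_iff _).2 fun V _ _ _ ρ hρ => (sigmaRep_le_sigmaRep_ind ρ).trans ?_
  have := finiteDimensional_indV ρ
  exact A.sigmaRep_le_sigma (A.isRational_ind hH hρ)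

theorem sigma_le_index_mul [Infinite k] {H : Subgroup G} (hH : IsClosed[A.zariski] (H : Set G))
    [H.FiniteIndex] : A.sigma ≤ (H.index : ℕ∞) * (A.ofClosed H hH).sigma := by
  refine A.sigma_le_iff.2 fun V _ _ _ ρ hρ => ?_
  have hres : (A.ofClosed H hH).IsRational (ρ.comp H.subtype) := fun φ x => ⟨_, hρ φ x, rfl⟩
  have hle := (A.ofClosed H hH).sigmaRep_le_sigma hres
  generalize (A.ofClosed H hH).sigma = s at hle
  induction s with
  | top =>
    -- The index is nonzero, so the right-hand side is infinite.
    rw [ENat.mul_top (by simpa using Subgroup.FiniteIndex.index_ne_zero)]; exact le_top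
  | coe d =>
    exact_mod_cast sigmaRep_le_of_isSigmaSet
      (isSigmaSet_index_mul ρ (isSigmaSet_of_sigmaRep_le hle))

/-! ### Finiteness of the component group -/

/-- Taking vanishing ideals is strictly antitone on closed sets, and the coordinate ring is
Noetherian. -/
theorem noetherianSpace_zariski : @TopologicalSpace.NoetherianSpace G A.zariski := by
  let := A.zariski
  have : Algebra.FiniteType k A.regular := A.regular.fg_iff_finiteType.1 A.fg
  have : IsNoetherianRing A.regular := Algebra.FiniteType.isNoetherianRing k _
  have hanti : StrictAnti fun Z : TopologicalSpace.Closeds G => A.vanishingIdeal (Z : Set G) := by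
    intro Y Z hYZ
    refine lt_of_le_not_ge (fun f hf => A.mem_vanishingIdeal.2 fun g hg =>
      A.mem_vanishingIdeal.1 hf g (hYZ.le hg)) fun hle => hYZ.not_ge fun g hg => ?_
    exact A.mem_of_forall_mem_vanishingIdeal Y.isClosed fun f hf =>
      A.mem_vanishingIdeal.1 (hle hf) g hg
  refine ((TopologicalSpace.noetherianSpace_TFAE G).out 0 1).2 ?_
  exact hanti.wellFoundedLT

/-- Points of `G` on a common irreducible component lie in one coset of `G⁰`, and a Noetherian space
has only finitely many irreducible components. -/
theorem finiteIndex_identityComponent : A.identityComponent.FiniteIndex := by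
  let := A.zariski
  have := A.noetherianSpace_zariski
  have hfin := TopologicalSpace.NoetherianSpace.finite_irreducibleComponents (α := G)
  have := hfin.to_subtype
  have : Finite (G ⧸ A.identityComponent) := by
    refine Finite.of_injective (β := irreducibleComponents G) (fun q =>
      ⟨irreducibleComponent q.out, irreducibleComponent_mem_irreducibleComponents _⟩) ?_
    intro p q hpq
    have hpq : irreducibleComponent p.out = irreducibleComponent q.out := congrArg Subtype.val hpq
    rw [← QuotientGroup.out_eq' p, ← QuotientGroup.out_eq' q, QuotientGroup.eq]
    have hpre := (isIrreducible_irreducibleComponent (x := p.out)).isPreirreducible.isPreconnected.image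
      (fun z => p.out⁻¹ * z) (A.continuous_mul_left _).continuousOn
    refine hpre.subset_connectedComponent ⟨p.out, mem_irreducibleComponent, by simp⟩
      ⟨q.out, ?_, rfl⟩
    rw [hpq]
    exact mem_irreducibleComponent
  exact Subgroup.finiteIndex_of_finite_quotient

end LinearAlgebraicGroup

/-! ### Comparison of `σ(G)` with `σ(H)` and `σ(G⁰)` -/

theorem mainTheorem7 {k : Type u} [Field k] [IsAlgClosed k] {G : Type v} [Group G]
    (A : LinearAlgebraicGroup k G) :
    (∀ (H : Subgroup G) (hH : IsClosed[A.zariski] (H : Set G)), H.FiniteIndex →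
      (∀ (V : Type w) [AddCommGroup V] [Module k V] [FiniteDimensional k V]
        (ρ : Representation k H V), (A.ofClosed H hH).IsRational ρ →
          (FiniteDimensional k (Representation.IndV H.subtype ρ) ∧
            A.IsRational (Representation.ind H.subtype ρ)) ∧
          sigmaRep ρ ≤ sigmaRep (Representation.ind H.subtype ρ) ∧
          sigmaRep (Representation.ind H.subtype ρ) ≤ A.sigma) ∧
      (A.ofClosed H hH).sigma ≤ A.sigma) ∧
    A.identityComponent.FiniteIndex ∧
    A.sigma ≤ (A.identityComponent.index : ℕ∞) *
      (A.ofClosed A.identityComponent A.isClosed_identityComponent).sigma ∧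
    (A.ofClosed A.identityComponent A.isClosed_identityComponent).sigma ≤ A.sigma ∧
    (A.sigma = ⊤ ↔
      (A.ofClosed A.identityComponent A.isClosed_identityComponent).sigma = ⊤) := by
  have := A.finiteIndex_identityComponent
  have hle := A.sigma_le_index_mul A.isClosed_identityComponent
  have hge := A.sigma_ofClosed_le A.isClosed_identityComponent
  refine ⟨fun H hH hfin => ⟨fun V _ _ _ ρ hρ => ?_, A.sigma_ofClosed_le hH⟩, this, hle, hge,
    fun h => ?_, fun h => top_le_iff.1 (h ▸ hge)⟩
  · have hfd := finiteDimensional_indV ρ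
    have hrat := A.isRational_ind hH hρ
    exact ⟨⟨hfd, hrat⟩, sigmaRep_le_sigmaRep_ind ρ, A.sigmaRep_le_sigma hrat⟩
  · by_contra hne
    rw [h, top_le_iff] at hle
    exact WithTop.mul_ne_top (ENat.natCast_ne_top _) hne hle
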